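/- Let $H$ be a finite graph with vertices $v_1,\dots,v_m$, possibly with multiple edges but without loops (it need not be connected); let $a_{ij}$ be the number of edges between $v_i$ and $v_j$, and $d_i=\sum_j a_{ij}$ the degree of $v_i$. For each $i$ let $s_{i,1}<s_{i,2}<\dots<s_{i,k_i}$ be a finite (possibly empty) sequence of positive integers. For $n\ge 1$ with $n>2s_{i,j}$ for all $i,j$, let $G_i=C_n(s_{i,1},\dots,s_{i,k_i})$ be the circulant graph on $\mathbb Z/n$ in which $k$ is adjacent to $k\pm s_{i,j}$, $1\le j\le k_i$ (no edges if $k_i=0$). Let $H_n=H_n(G_1,\dots,G_m)$ be the circulant foliation over $H$ with fibres $G_1,\dots,G_m$: its vertices are the pairs $(k,v_i)$, $k\in\mathbb Z/n$, $1\le i\le m$; for each $k$ and $i\ne j$ there are $a_{ij}$ edges between $(k,v_i)$ and $(k,v_j)$; and for each $i$ the vertices $(k,v_i)$, $k\in\mathbb Z/n$, carry the graph $G_i$. There are no other edges. A rooted spanning forest of a graph is a spanning subgraph without cycles together with a choice of one root vertex in each of its connected components. Let $f(n)$ and $f(H)$ be the numbers of rooted spanning forests of $H_n$ and of $H$. For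 $X=(x_1,\dots,x_m)$ let $L(H,X)=\mathrm{diag}(x_1,\dots,x_m)-(a_{ij})_{i,j}$, and let $Q(w)=\det L(H,W(w))$, where $W(w)=(w_1,\dots,w_m)$, $w_i=2k_i+d_i+1-\sum_{j=1}^{k_i}2T_{s_{i,j}}(w)$, and $T_k$ is the $k$-th Chebyshev polynomial of the first kind. Then $Q(-1)=\det L(H,W)$ with $W=(d_1+4t_1+1,\dots,d_m+4t_m+1)$, where $t_i$ is the number of odd integers among $s_{i,1},\dots,s_{i,k_i}$; and $Q(-1)$ is a positive integer. Let $p$ be its square-free part, that is, the unique square-free positive integer $p$ with $Q(-1)=p\,r^2$ for some positive integer $r$. Then there is an integer sequence $a(n)$ such that, for all $n$ as above, 1. $f(n)=f(H)\,a(n)^2$ if $n$ is odd, 2. $f(n)=p\,f(H)\,a(n)^2$ if $n$ is even. -/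

import Mathlib

/-! Multigraphs are Mathlib's `Graph α β`: a vertex set in `α`, an edge set in `β`, and a relation
`G.IsLink e x y` saying that the edge `e` joins `x` and `y`. -/

namespace CirculantFoliation

variable {α β : Type*}

/-- A multigraph is a forest if it has no cycles: no loops (cycles of length one), no pairs of
parallel edges (cycles of length two), and no longer cycles. -/
def IsForest (F : Graph α β) : Prop :=
  F.Simple ∧ F.toSimpleGraph.IsAcyclic

/-- `(F, R)` is a rooted spanning forest of `G`: `F` is a spanning subgraph of `G` that is a forest,
and the set `R` of roots contains exactly one vertex of every connected component of `F`. -/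
structure IsRootedSpanningForest (G F : Graph α β) (R : Set α) : Prop where
  spanning : F.IsSpanningSubgraph G
  forest : IsForest F
  roots_subset : R ⊆ F.vertexSet
  existsUnique_root : ∀ c : F.toSimpleGraph.ConnectedComponent,
    ∃! r : F.vertexSet, (r : α) ∈ R ∧ F.toSimpleGraph.connectedComponentMk r = c

/-- The number of rooted spanning forests of a (finite) multigraph. -/
noncomputable def numRootedSpanningForests (G : Graph α β) : ℕ :=
  {p : Graph α β × Set α | IsRootedSpanningForest G p.1 p.2}.ncard

/-- `a_{uv}`: the number of edges between `u` and `v`. -/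
noncomputable def edgeMult (H : Graph α β) (u v : H.vertexSet) : ℕ :=
  {e : β | H.IsLink e u v}.ncard

/-- The degree `d_v = ∑_u a_{uv}` of a vertex of a loopless multigraph. -/
noncomputable def deg (H : Graph α β) [Fintype H.vertexSet] (v : H.vertexSet) : ℕ :=
  ∑ u, edgeMult H u v

/-- The generalized Laplacian `L(H, X) = diag(X) - A(H)`. -/
noncomputable def genLaplacian {A : Type*} [CommRing A] [DecidableEq α] (H : Graph α β)
    (x : H.vertexSet → A) : Matrix H.vertexSet H.vertexSet A :=
  Matrix.diagonal x - Matrix.of fun u v => (edgeMult H u v : A)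

/-- The circulant graph `C_n(s_1, …, s_k)` on `ℤ/n` with set of jumps `{s_1, …, s_k}`;
the empty set of jumps gives the graph without edges. -/
def circulant (n : ℕ) (S : Finset ℕ) : SimpleGraph (ZMod n) :=
  SimpleGraph.circulantGraph ((fun s : ℕ => (s : ZMod n)) '' (S : Set ℕ))

/-- The graph obtained from `n` copies of `H`, indexed by `ZMod n`, by adding for each vertex
`v` of `H` the edges of the graph `G v` between the `n` copies `(k, v)` of `v`. The edge
`inl (k, e)` is the `k`-th copy of the edge `e` of `H`, and `inr (v, s(k, l))` is the edge
joining `(k, v)` and `(l, v)` in the fibre over `v`. -/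
def foliation (H : Graph α β) (n : ℕ) (G : H.vertexSet → SimpleGraph (ZMod n)) :
    Graph (ZMod n × α) ((ZMod n × β) ⊕ (H.vertexSet × Sym2 (ZMod n))) where
  vertexSet := {x | x.2 ∈ H.vertexSet}
  IsLink
    | Sum.inl (k, e), x, y => x.1 = k ∧ y.1 = k ∧ H.IsLink e x.2 y.2
    | Sum.inr (v, e), x, y => x.2 = v ∧ y.2 = v ∧ e = s(x.1, y.1) ∧ (G v).Adj x.1 y.1
  isLink_symm := by
    rintro (⟨k, e⟩ | ⟨v, e⟩) -
    · exact ⟨fun x y h => ⟨h.2.1, h.1, h.2.2.symm⟩⟩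
    · exact ⟨fun x y h => ⟨h.2.1, h.1, by rw [h.2.2.1, Sym2.eq_swap], h.2.2.2.symm⟩⟩
  eq_or_eq_of_isLink_of_isLink := by
    rintro (⟨k, e⟩ | ⟨v, e⟩) ⟨x₁, x₂⟩ ⟨y₁, y₂⟩ ⟨z₁, z₂⟩ ⟨w₁, w₂⟩ h h'
    · obtain ⟨rfl, rfl, h⟩ := h
      obtain ⟨h₁, h₂, h'⟩ := h'
      rcases h.left_eq_or_eq h' with h'' | h''
      · exact Or.inl (Prod.ext h₁.symm h'')
      · exact Or.inr (Prod.ext h₂.symm h'')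
    · obtain ⟨h₁, h₂, rfl, -⟩ := h
      obtain ⟨h₃, h₄, h₅, -⟩ := h'
      dsimp only at h₁ h₂ h₃ h₄ h₅
      rcases Sym2.eq_iff.1 h₅ with h | h
      · exact Or.inl (Prod.ext h.1 (h₁.trans h₃.symm))
      · exact Or.inr (Prod.ext h.1 (h₁.trans h₄.symm))
  left_mem_of_isLink := by
    rintro (⟨k, e⟩ | ⟨v, e⟩) x y h
    · exact h.2.2.left_mem
    · have h1 : x.2 = v := h.1
      change x.2 ∈ H.vertexSet
      rw [h1]
      exact v.2

/-- The circulant foliation `H_n = H_n(G_1, …, G_m)` over `H` whose fibre over the vertex `v` is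
the circulant graph on `n` vertices with set of jumps `S v`. -/
def circulantFoliation (H : Graph α β) (S : H.vertexSet → Finset ℕ) (n : ℕ) :
    Graph (ZMod n × α) ((ZMod n × β) ⊕ (H.vertexSet × Sym2 (ZMod n))) :=
  foliation H n fun v => circulant n (S v)

open Polynomial in
/-- The polynomial `Q(w) = det L(H, W)` with `w_v = 2 k_v + d_v + 1 - ∑_{s ∈ S v} 2 T_s(w)`,
where `k_v` is the number of jumps in the fibre over `v` and `T_s` are the Chebyshev polynomials
of the first kind. -/
noncomputable def polyQ [DecidableEq α] (H : Graph α β) [Fintype H.vertexSet]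
    (S : H.vertexSet → Finset ℕ) : ℤ[X] :=
  (genLaplacian H fun v => (2 * ((S v).card : ℤ[X]) + (deg H v : ℤ[X]) + 1
    - ∑ s ∈ S v, 2 * Chebyshev.T ℤ (s : ℤ))).det

/-- `t_v`: the number of odd jumps in the fibre over `v`. -/
def numOddJumps {V : Type*} (S : V → Finset ℕ) (v : V) : ℕ :=
  ((S v).filter Odd).card

/-- `p` is the square-free part of the integer `N`: `N = p * r ^ 2` with `p`, `r` positive integers
and `p` square-free. (Such a `p` exists, and is then unique, if and only if `N` is positive.) -/
def IsSquarefreePart (p : ℕ) (N : ℤ) : Prop :=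
  Squarefree p ∧ ∃ r : ℕ, 0 < r ∧ N = (p : ℤ) * (r : ℤ) ^ 2

end CirculantFoliation

/-! A matrix forest theorem expresses f(n) as the determinant of the identity plus the Laplacian of
H_n. Expanding by rows over all choices of at most one outgoing edge at each vertex, an acyclic
choice (a forest oriented towards its roots) contributes 1 and any other choice 0.

Translation by ℤ/n makes this matrix block circulant, so the discrete Fourier transform factors the
determinant as ∏_j P(ζ^j + ζ^(-j)), where ζ is a primitive n-th root of unity and P is the integer
polynomial with Q(w) = P(2w). The points ζ^j + ζ^(-j) are, with multiplicity, the roots of C_n - 2,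
where C_n(x) = 2 T_n(x/2).

Since C_n(z + 1/z) - 2 = (z^(n/2) - z^(-n/2))^2, this polynomial is (x - 2) V^2 for odd n and (x -
2)(x + 2) V^2 for even n, with V integral. The product of P over the roots of V is, up to sign, a
resultant of integer polynomials, hence an integer, and it enters squared. What remains is P(2) =
f(H) and, for even n, also P(-2) = Q(-1) = p r^2, whose factor r^2 is absorbed in the square.
Positivity of Q(-1) comes from positive definiteness of a Laplacian plus a positive diagonal. -/

namespace CirculantFoliation

/-! ### Parent maps, their determinants and their underlying forests. -/

section ParentMap

variable {V : Type*}

/-- The parent map `par` defines a rooted forest: iterating it always ends in a root. -/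
def IsForestMap (par : V → Option V) : Prop :=
  WellFounded fun u v => par v = some u

/-- `w` is a descendant of `t` (possibly `t` itself). -/
def IsDescendant (par : V → Option V) (w t : V) : Prop :=
  Relation.ReflTransGen (fun a b => par a = some b) w t

lemma isDescendant_iff_parent {par : V → Option V} {w p t : V} (h : par w = some p) (hwt : w ≠ t) :
    IsDescendant par w t ↔ IsDescendant par p t := by
  constructor
  · intro hd
    rcases Relation.ReflTransGen.cases_head hd with rfl | ⟨q, hq, hd⟩
    · exact absurd rfl hwt
    · obtain rfl : p = q := by simpa [h] using hq
      exact hd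
  · exact fun hd => Relation.ReflTransGen.head h hd

/-- A cycle through `v` also passes through the parent of `v`, so a counterexample moves down the
well-founded relation forever. -/
lemma IsForestMap.not_isDescendant_parent {par : V → Option V} (hpar : IsForestMap par) {v p : V}
    (h : par v = some p) : ¬ IsDescendant par p v := by
  revert p
  induction v using hpar.induction with
  | _ v ih =>
    intro p h hd
    rcases Relation.ReflTransGen.cases_tail hd with rfl | ⟨q, hq, hqv⟩
    · exact ih v h h Relation.ReflTransGen.refl
    · rcases eq_or_ne p v with rfl | hne
      · exact ih p h h Relation.ReflTransGen.refl
      · rcases Relation.ReflTransGen.cases_head hd with rfl | ⟨q', hq', hd'⟩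
        · exact hne rfl
        · exact ih p h hq' (hd'.tail h)

lemma IsForestMap.parent_parent_ne {par : V → Option V} (hpar : IsForestMap par) {u v : V}
    (h : par v = some u) : par u ≠ some v :=
  fun h' => hpar.not_isDescendant_parent h (Relation.ReflTransGen.single h')

lemma IsForestMap.parent_ne_self {par : V → Option V} (hpar : IsForestMap par) (v : V) :
    par v ≠ some v :=
  fun h => hpar.not_isDescendant_parent h Relation.ReflTransGen.refl

/-- The matrix `1 - N`, where `N` is the transition matrix of the parent map. -/
def parentMatrix [DecidableEq V] (par : V → Option V) : Matrix V V ℤ :=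
  Matrix.of fun v => Pi.single v 1 - (par v).elim 0 fun u => Pi.single u 1

/-- Sorting the vertices by well-founded rank makes the matrix block triangular with identity
diagonal blocks. -/
lemma det_parentMatrix_of_isForestMap [Fintype V] [DecidableEq V] {par : V → Option V}
    (hpar : IsForestMap par) : (parentMatrix par).det = 1 := by
  classical
  have : IsWellFounded V (fun u v => par v = some u) := ⟨hpar⟩
  -- A parent has smaller rank than its child; the order dual turns this into the orientation
  -- required by `BlockTriangular`.
  let b : V → Ordinalᵒᵈ := fun v =>
    OrderDual.toDual (IsWellFounded.rank (fun u v => par v = some u) v)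
  have key : ∀ v w, b w ≤ b v → parentMatrix par v w = (1 : Matrix V V ℤ) v w := by
    intro v w hb
    rw [parentMatrix, Matrix.of_apply, Matrix.one_apply]
    rcases hv : par v with _ | u
    · simp [Pi.single_apply, eq_comm]
    · have hlt := IsWellFounded.rank_lt_of_rel (r := fun u v => par v = some u) hv
      have hwu : w ≠ u := by
        rintro rfl
        exact absurd hlt (not_lt.2 hb)
      simp [Pi.single_apply, hwu, eq_comm]
  have hT : (parentMatrix par).BlockTriangular b := by
    intro v w hb
    rw [key v w hb.le, Matrix.one_apply_ne]
    rintro rfl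
    exact lt_irrefl _ hb
  rw [hT.det]
  refine Finset.prod_eq_one fun a _ => ?_
  have hone : (parentMatrix par).toSquareBlock b a = 1 := by
    ext ⟨v, hv⟩ ⟨w, hw⟩
    rw [Matrix.toSquareBlock_def, Matrix.of_apply, key v w (hw.trans hv.symm).le]
    simp [Matrix.one_apply]
  rw [hone, Matrix.det_one]

/-- The indicator of the inaccessible vertices is a nonzero kernel vector: roots are accessible, and
any other vertex is accessible exactly when its parent is. -/
lemma det_parentMatrix_of_not_isForestMap [Fintype V] [DecidableEq V] {par : V → Option V}
    (hpar : ¬ IsForestMap par) : (parentMatrix par).det = 0 := by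
  classical
  obtain ⟨v₀, hv₀⟩ : ∃ v, ¬ Acc (fun u v => par v = some u) v := by
    by_contra! h
    exact hpar ⟨h⟩
  rw [← Matrix.exists_mulVec_eq_zero_iff]
  refine ⟨fun v => if Acc (fun u v => par v = some u) v then 0 else 1, ?_, ?_⟩
  · intro h
    simpa [hv₀] using congrFun h v₀
  · ext v
    rcases hv : par v with _ | u
    · have : Acc (fun u v => par v = some u) v := ⟨_, fun u hu => by simp [hv] at hu⟩
      simp [parentMatrix, Matrix.mulVec, hv, this]
    · have : Acc (fun u v => par v = some u) v ↔ Acc (fun u v => par v = some u) u :=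
        ⟨fun h => h.inv hv, fun h => ⟨_, fun w hw => by
          obtain rfl : u = w := by simpa [hv] using hw
          exact h⟩⟩
      change (Pi.single v 1 - (par v).elim 0 fun u => Pi.single u 1 : V → ℤ) ⬝ᵥ _ = 0
      simp [hv, this, sub_dotProduct]

variable {T : SimpleGraph V} {par : V → Option V}

/-- Each edge from `v` to its parent is a bridge: a walk from `v` avoiding that edge stays among the
descendants of `v`, and the parent is not one of them. -/
lemma IsForestMap.isAcyclic (hpar : IsForestMap par)
    (hT : ∀ a b, T.Adj a b ↔ par a = some b ∨ par b = some a) : T.IsAcyclic := by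
  have key : ∀ v p, par v = some p → T.IsBridge s(v, p) := by
    intro v p h
    rw [SimpleGraph.isBridge_iff]
    intro hr
    have : ∀ w, (T.deleteEdges {s(v, p)}).Reachable v w → IsDescendant par w v := by
      intro w hw
      rw [SimpleGraph.reachable_iff_reflTransGen] at hw
      induction hw with
      | refl => exact Relation.ReflTransGen.refl
      | @tail a b _ hab ih =>
        rw [SimpleGraph.deleteEdges_adj] at hab
        obtain ⟨hab, hne⟩ := hab
        rcases (hT a b).1 hab with h' | h'
        · refine (isDescendant_iff_parent h' ?_).1 ih
          rintro rfl
          obtain rfl : p = b := by simpa [h] using h'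
          exact hne rfl
        · refine (isDescendant_iff_parent h' ?_).2 ih
          rintro rfl
          obtain rfl : p = a := by simpa [h] using h'
          exact hne Sym2.eq_swap
    exact hpar.not_isDescendant_parent h (this p hr)
  rw [SimpleGraph.isAcyclic_iff_forall_adj_isBridge]
  intro v w hvw
  rcases (hT v w).1 hvw with h | h
  · exact key v w h
  · rw [Sym2.eq_swap]
    exact key w v h

/-- Following parents reaches a root. Conversely, whatever is connected to a root `s` descends from
`s`, and a root descends only from itself. -/
lemma IsForestMap.existsUnique_root (hpar : IsForestMap par)
    (hT : ∀ a b, T.Adj a b ↔ par a = some b ∨ par b = some a) (c : T.ConnectedComponent) :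
    ∃! r, par r = none ∧ T.connectedComponentMk r = c := by
  induction c using SimpleGraph.ConnectedComponent.ind with
  | _ v =>
  refine existsUnique_of_exists_of_unique ?_ ?_
  · induction v using hpar.induction with
    | _ v ih =>
      rcases hv : par v with _ | u
      · exact ⟨v, hv, rfl⟩
      · obtain ⟨r, hr, hru⟩ := ih u hv
        refine ⟨r, hr, hru.trans ?_⟩
        exact SimpleGraph.ConnectedComponent.sound ((hT u v).2 (Or.inr hv)).reachable
  · rintro r s ⟨hr, hrv⟩ ⟨hs, hsv⟩
    have hrs : T.Reachable s r := SimpleGraph.ConnectedComponent.exact (hsv.trans hrv.symm)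
    have : IsDescendant par r s := by
      clear hr hrv
      rw [SimpleGraph.reachable_iff_reflTransGen] at hrs
      induction hrs with
      | refl => exact Relation.ReflTransGen.refl
      | @tail a b _ hab ih =>
        rcases (hT a b).1 hab with h' | h'
        · exact (isDescendant_iff_parent h' (by rintro rfl; simp [hs] at h')).1 ih
        · exact (isDescendant_iff_parent h' (by rintro rfl; simp [hs] at h')).2 ih
    rcases Relation.ReflTransGen.cases_head this with h | ⟨q, hq, -⟩
    · exact h
    · simp [hr] at hq

end ParentMap

end CirculantFoliation
namespace CirculantFoliation

/-! ### Rooted spanning forests as edge choices, and the matrix forest theorem. -/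

section ForestTheorem

variable {α β : Type*}

/-- The edges of `G` leaving the vertex `v`, together with their other end. -/
abbrev OutEdge (G : Graph α β) (v : G.vertexSet) : Type _ :=
  Σ u : G.vertexSet, {e : β // G.IsLink e v u}

/-- The parent map of a choice of at most one edge at every vertex. -/
def parentOf {G : Graph α β} (φ : ∀ v, Option (OutEdge G v)) (v : G.vertexSet) :
    Option G.vertexSet :=
  (φ v).map Sigma.fst

/-- The set of edges which are chosen at some vertex. -/
def chosenEdges {G : Graph α β} (φ : ∀ v, Option (OutEdge G v)) : Set β :=
  {e | ∃ v, ∃ c : OutEdge G v, φ v = some c ∧ (c.2 : β) = e}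

/-- The set of vertices at which no edge is chosen. -/
def chosenRoots {G : Graph α β} (φ : ∀ v, Option (OutEdge G v)) : Set α :=
  Subtype.val '' {v | φ v = none}

variable {G : Graph α β} {φ : ∀ v, Option (OutEdge G v)}

lemma parentOf_eq_none {v : G.vertexSet} : parentOf φ v = none ↔ φ v = none := by
  simp [parentOf]

lemma parentOf_eq_some {v u : G.vertexSet} :
    parentOf φ v = some u ↔ ∃ e, ∃ h : G.IsLink e v u, φ v = some ⟨u, e, h⟩ := by
  rcases h : φ v with _ | ⟨w, e, he⟩
  · simp [parentOf, h]
  · simp only [parentOf, h, Option.map_some, Option.some.injEq]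
    constructor
    · rintro rfl
      exact ⟨e, he, rfl⟩
    · rintro ⟨f, hf, hh⟩
      exact congrArg Sigma.fst hh

lemma mem_chosenEdges_iff {x y : G.vertexSet} {e : β} (he : G.IsLink e x y) :
    e ∈ chosenEdges φ ↔ φ x = some ⟨y, e, he⟩ ∨ φ y = some ⟨x, e, he.symm⟩ := by
  constructor
  · rintro ⟨v, ⟨u, f, hf⟩, hφ, rfl⟩
    rcases hf.eq_and_eq_or_eq_and_eq he with ⟨h₁, h₂⟩ | ⟨h₁, h₂⟩
    · obtain rfl := Subtype.ext h₁
      obtain rfl := Subtype.ext h₂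
      exact Or.inl hφ
    · obtain rfl := Subtype.ext h₁
      obtain rfl := Subtype.ext h₂
      exact Or.inr hφ
  · rintro (h | h)
    · exact ⟨_, _, h, rfl⟩
    · exact ⟨_, _, h, rfl⟩

lemma val_mem_chosenRoots {v : G.vertexSet} : (v : α) ∈ chosenRoots φ ↔ φ v = none := by
  simp [chosenRoots]

lemma adj_restrict_chosenEdges (hφ : IsForestMap (parentOf φ)) (a b : G.vertexSet) :
    (G.restrict (chosenEdges φ)).toSimpleGraph.Adj a b ↔
      parentOf φ a = some b ∨ parentOf φ b = some a := by
  constructor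
  · rintro ⟨-, e, he, hl⟩
    rcases (mem_chosenEdges_iff hl).1 he with h | h
    · exact Or.inl (parentOf_eq_some.2 ⟨_, _, h⟩)
    · exact Or.inr (parentOf_eq_some.2 ⟨_, _, h⟩)
  · rintro (h | h)
    · refine ⟨fun hab => hφ.parent_ne_self a (by rw [h]; exact congrArg some hab.symm), ?_⟩
      obtain ⟨e, he, hs⟩ := parentOf_eq_some.1 h
      exact ⟨e, ⟨_, _, hs, rfl⟩, he⟩
    · refine ⟨fun hab => hφ.parent_ne_self b (by rw [h]; exact congrArg some hab), ?_⟩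
      obtain ⟨e, he, hs⟩ := parentOf_eq_some.1 h
      exact ⟨e, ⟨_, _, hs, rfl⟩, he.symm⟩

lemma simple_restrict_chosenEdges (hφ : IsForestMap (parentOf φ)) :
    (G.restrict (chosenEdges φ)).Simple where
  not_isLoopAt := by
    rintro e x ⟨he, hl⟩
    have hx := hl.left_mem
    have hp : parentOf φ ⟨x, hx⟩ = some ⟨x, hx⟩ := by
      rcases (mem_chosenEdges_iff (x := ⟨x, hx⟩) (y := ⟨x, hx⟩) hl).1 he with h | h <;>
        exact parentOf_eq_some.2 ⟨_, _, h⟩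
    exact hφ.parent_ne_self _ hp
  eq_of_isLink := by
    rintro e f x y ⟨he, hle⟩ ⟨hf, hlf⟩
    have key : ∀ (e f : β) (x y : G.vertexSet) (hle : G.IsLink e x y) (hlf : G.IsLink f x y),
        φ x = some ⟨y, e, hle⟩ → f ∈ chosenEdges φ → e = f := by
      intro e f x y hle hlf he hf
      rcases (mem_chosenEdges_iff hlf).1 hf with h | h
      · rw [he] at h
        simpa using h
      · exact absurd (parentOf_eq_some.2 ⟨_, _, h⟩)
          (hφ.parent_parent_ne (parentOf_eq_some.2 ⟨_, _, he⟩))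
    rcases (mem_chosenEdges_iff (x := ⟨x, hle.left_mem⟩) (y := ⟨y, hle.right_mem⟩) hle).1 he
      with h | h
    · exact key _ _ _ _ _ hlf h hf
    · exact key _ _ _ _ _ hlf.symm h hf

lemma isRootedSpanningForest_of_isForestMap (hφ : IsForestMap (parentOf φ)) :
    IsRootedSpanningForest G (G.restrict (chosenEdges φ)) (chosenRoots φ) where
  spanning := ⟨Graph.restrict_le, rfl⟩
  forest := ⟨simple_restrict_chosenEdges hφ, hφ.isAcyclic (adj_restrict_chosenEdges hφ)⟩
  roots_subset := by
    rintro _ ⟨v, -, rfl⟩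
    exact v.2
  existsUnique_root c := by
    obtain ⟨r, ⟨hr, hc⟩, hu⟩ := hφ.existsUnique_root (adj_restrict_chosenEdges hφ) c
    refine ⟨r, ⟨val_mem_chosenRoots.2 (parentOf_eq_none.1 hr), hc⟩, ?_⟩
    rintro s ⟨hs, hsc⟩
    exact hu s ⟨parentOf_eq_none.2 (val_mem_chosenRoots.1 hs), hsc⟩

/-- The choice is recovered from the roots upwards. The edge from `v` to its parent must be chosen
by `ψ` at one of its ends; at the parent, `ψ` already agrees with `φ` by induction, which would give
a 2-cycle. -/
lemma eq_of_chosenEdges_eq {ψ : ∀ v, Option (OutEdge G v)} (hφ : IsForestMap (parentOf φ))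
    (hE : chosenEdges φ = chosenEdges ψ) (hR : chosenRoots φ = chosenRoots ψ) : φ = ψ := by
  funext v
  induction v using hφ.induction with
  | _ v ih =>
    rcases hv : φ v with _ | ⟨u, e, he⟩
    · have : (v : α) ∈ chosenRoots ψ := hR ▸ val_mem_chosenRoots.2 hv
      exact (val_mem_chosenRoots.1 this).symm
    · have hp : parentOf φ v = some u := parentOf_eq_some.2 ⟨_, _, hv⟩
      have : e ∈ chosenEdges ψ := hE ▸ ⟨_, _, hv, rfl⟩
      rcases (mem_chosenEdges_iff he).1 this with h | h
      · exact h.symm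
      · rw [← ih u hp] at h
        exact absurd (parentOf_eq_some.2 ⟨_, _, h⟩) (hφ.parent_parent_ne hp)

lemma exists_adj_dist_lt {V : Type*} {T : SimpleGraph V} {r v : V} (h : T.Reachable r v)
    (hne : v ≠ r) : ∃ u, T.Adj v u ∧ T.dist r u < T.dist r v := by
  obtain ⟨p, hp⟩ := h.symm.exists_walk_length_eq_dist
  cases p with
  | nil => exact absurd rfl hne
  | @cons _ u _ huv q =>
    refine ⟨u, huv, ?_⟩
    rw [SimpleGraph.dist_comm, SimpleGraph.dist_comm (v := v), ← hp, SimpleGraph.Walk.length_cons]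
    exact Nat.lt_succ_of_le (SimpleGraph.dist_le q)

/-- Let every vertex outside `R` choose an edge to a neighbour closer to the root of its component;
the distance to the root decreases along parents. -/
lemma exists_isForestMap_of_restrict {E₀ : Set β} {R : Set α}
    (h : IsRootedSpanningForest G (G.restrict E₀) R) :
    ∃ φ : ∀ v, Option (OutEdge G v), IsForestMap (parentOf φ) ∧
      G.restrict (chosenEdges φ) = G.restrict E₀ ∧ chosenRoots φ = R := by
  classical
  have := h.forest.1
  let T : SimpleGraph G.vertexSet := (G.restrict E₀).toSimpleGraph
  have hT : T.IsAcyclic := h.forest.2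
  have hroot : ∀ c : T.ConnectedComponent,
    ∃! r : G.vertexSet, (r : α) ∈ R ∧ T.connectedComponentMk r = c := h.existsUnique_root
  choose root hroot hroot_unique using hroot
  let r : G.vertexSet → G.vertexSet := fun v => root (T.connectedComponentMk v)
  have hrR : ∀ v, (r v : α) ∈ R := fun v => (hroot _).1
  have hreach : ∀ v, T.Reachable (r v) v := fun v =>
    SimpleGraph.ConnectedComponent.exact (hroot (T.connectedComponentMk v)).2
  have hr_of_mem : ∀ v : G.vertexSet, (v : α) ∈ R → r v = v := fun v hv =>
    (hroot_unique _ v ⟨hv, rfl⟩).symm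
  have hr_adj : ∀ {u v}, T.Adj u v → r u = r v := fun {u v} huv =>
    congrArg root (SimpleGraph.ConnectedComponent.sound huv.reachable)
  have hstep : ∀ v : G.vertexSet, (v : α) ∉ R →
      ∃ c : OutEdge G v, (c.2 : β) ∈ E₀ ∧ T.Adj v c.1 ∧ T.dist (r v) c.1 < T.dist (r v) v := by
    intro v hv
    have hne : v ≠ r v := fun h' => hv (h' ▸ hrR v)
    obtain ⟨u, huv, hd⟩ := exists_adj_dist_lt (hreach v) hne
    obtain ⟨-, e, he, hl⟩ := id huv
    exact ⟨⟨u, e, hl⟩, he, huv, hd⟩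
  choose step hstepE hstepA hstepD using hstep
  let φ : ∀ v, Option (OutEdge G v) := fun v =>
    if hv : (v : α) ∈ R then none else some (step v hv)
  have hφsome : ∀ {v c}, φ v = some c → ∃ hv : (v : α) ∉ R, c = step v hv := by
    intro v c hc
    by_cases hv : (v : α) ∈ R
    · simp [φ, hv] at hc
    · exact ⟨hv, by simpa [φ, hv, eq_comm] using hc⟩
  have hφnone : ∀ {v}, φ v = none ↔ (v : α) ∈ R := by
    intro v
    by_cases hv : (v : α) ∈ R <;> simp [φ, hv]
  have hwf : IsForestMap (parentOf φ) := by
    refine Subrelation.wf ?_ (measure fun v => T.dist (r v) v).wf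
    intro u v huv
    obtain ⟨e, he, hs⟩ := parentOf_eq_some.1 huv
    obtain ⟨hv, hc⟩ := hφsome hs
    have h₁ := hstepA v hv
    have h₂ := hstepD v hv
    rw [← hc] at h₁ h₂
    change T.dist (r u) u < T.dist (r v) v
    rwa [← hr_adj h₁]
  refine ⟨φ, hwf, ?_, ?_⟩
  · have hsub : chosenEdges φ ⊆ E₀ := by
      rintro _ ⟨v, c, hc, rfl⟩
      obtain ⟨hv, rfl⟩ := hφsome hc
      exact hstepE v hv
    refine le_antisymm (Graph.restrict_mono_right G hsub) ⟨subset_rfl, ?_⟩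
    rintro e x' y' ⟨he, hl⟩
    refine ⟨?_, hl⟩
    by_contra hnot
    obtain ⟨x, rfl⟩ : ∃ x : G.vertexSet, (x : α) = x' := ⟨⟨x', hl.left_mem⟩, rfl⟩
    obtain ⟨y, rfl⟩ : ∃ y : G.vertexSet, (y : α) = y' := ⟨⟨y', hl.right_mem⟩, rfl⟩
    have hadj : T.Adj x y := by
      have hl' : (G.restrict E₀).IsLink e x y := ⟨he, hl⟩
      exact ⟨fun hxy => hl'.ne (congrArg Subtype.val hxy), _, hl'⟩
    -- If `e` were chosen at neither end, chosen edges would lead every vertex to its root without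
    -- using `s(x, y)`. Then `x` and `y` would stay connected after its deletion, although every
    -- edge of an acyclic graph is a bridge.
    have hpath : ∀ v, (T.deleteEdges {s(x, y)}).Reachable v (r v) := by
      intro v
      induction v using hwf.induction with
      | _ v ih =>
        rcases hv : φ v with _ | ⟨u, f, hf⟩
        · rw [hr_of_mem v (hφnone.1 hv)]
        · obtain ⟨hvR, hc⟩ := hφsome hv
          have hA := hstepA v hvR
          have hE := hstepE v hvR
          rw [← hc] at hA hE
          have hu := ih u (parentOf_eq_some.2 ⟨_, _, hv⟩)
          rw [← hr_adj hA] at hu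
          refine SimpleGraph.Reachable.trans (SimpleGraph.Adj.reachable ?_) hu
          rw [SimpleGraph.deleteEdges_adj]
          refine ⟨hA, fun hs => hnot ?_⟩
          have hfe : f = e := by
            have hf' : (G.restrict E₀).IsLink f v u := ⟨hE, hf⟩
            have he' : (G.restrict E₀).IsLink e x y := ⟨he, hl⟩
            rcases Sym2.eq_iff.1 hs with ⟨rfl, rfl⟩ | ⟨rfl, rfl⟩
            · exact hf'.eq he'
            · exact hf'.eq he'.symm
          exact hfe ▸ ⟨_, _, hv, rfl⟩
    refine SimpleGraph.isBridge_iff.1 (SimpleGraph.isAcyclic_iff_forall_adj_isBridge.1 hT hadj) ?_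
    exact (hpath x).trans (hr_adj hadj ▸ (hpath y).symm)
  · ext x
    constructor
    · rintro ⟨v, hv, rfl⟩
      exact hφnone.1 hv
    · intro hx
      exact ⟨⟨x, h.roots_subset hx⟩, hφnone.2 hx, rfl⟩

lemma image_isForestMap :
    (fun φ : ∀ v, Option (OutEdge G v) => (G.restrict (chosenEdges φ), chosenRoots φ)) ''
      {φ | IsForestMap (parentOf φ)} = {p | IsRootedSpanningForest G p.1 p.2} := by
  ext ⟨F, R⟩
  constructor
  · rintro ⟨φ, hφ, h⟩
    obtain ⟨rfl, rfl⟩ := Prod.mk.inj h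
    exact isRootedSpanningForest_of_isForestMap hφ
  · intro h
    have hF : F = G.restrict F.edgeSet := by
      refine le_antisymm
        (Graph.IsSubgraph.mk h.spanning.vertexSet_eq.le fun e x y he => ⟨he.edge_mem, ?_⟩)
        (Graph.IsSubgraph.mk h.spanning.vertexSet_eq.ge fun e x y he => ?_)
      · exact he.mono h.spanning.le
      · exact (h.spanning.le.isLink_iff he.1).2 he.2
    change IsRootedSpanningForest G F R at h
    rw [hF] at h ⊢
    obtain ⟨φ, hφ, h₁, h₂⟩ := exists_isForestMap_of_restrict h
    exact ⟨φ, hφ, Prod.ext h₁ h₂⟩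

lemma numRootedSpanningForests_eq_ncard :
    numRootedSpanningForests G = {φ : ∀ v, Option (OutEdge G v) | IsForestMap (parentOf φ)}.ncard := by
  rw [numRootedSpanningForests, ← image_isForestMap]
  refine Set.InjOn.ncard_image ?_
  intro φ hφ ψ _ h
  obtain ⟨h₁, h₂⟩ := Prod.mk.inj h
  refine eq_of_chosenEdges_eq hφ ?_ h₂
  have key : ∀ χ : ∀ v, Option (OutEdge G v), (G.restrict (chosenEdges χ)).edgeSet = chosenEdges χ := by
    intro χ
    refine Set.inter_eq_right.2 ?_
    rintro _ ⟨v, c, -, rfl⟩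
    exact c.2.2.edge_mem
  rw [← key φ, h₁, key ψ]

lemma edgeMult_comm (G : Graph α β) (u v : G.vertexSet) : edgeMult G u v = edgeMult G v u := by
  simp only [edgeMult, Graph.isLink_comm (x := (u : α))]

/-- **Matrix forest theorem**: the number of rooted spanning forests of a finite multigraph is the
determinant of the sum of the identity matrix and its Laplacian matrix. -/
theorem numRootedSpanningForests_eq_det [DecidableEq α] [Fintype G.vertexSet]
    (hE : G.edgeSet.Finite) :
    (numRootedSpanningForests G : ℤ) = (genLaplacian G fun v => (deg G v : ℤ) + 1).det := by
  classical
  have hfin : ∀ u v : G.vertexSet, Finite {e : β // G.IsLink e u v} := fun u v =>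
    (hE.subset fun e he => he.edge_mem : {e : β | G.IsLink e u v}.Finite)
  have : ∀ u v : G.vertexSet, Fintype {e : β // G.IsLink e u v} := fun u v => Fintype.ofFinite _
  -- Choosing no edge at `v` gives the unit vector e_v, which accounts for the added identity;
  -- choosing an edge to `u` gives e_v - e_u.
  let row : ∀ v : G.vertexSet, Option (OutEdge G v) → G.vertexSet → ℤ := fun v c =>
    Pi.single v 1 - (c.map Sigma.fst).elim 0 fun u => Pi.single u 1
  have hrow : (genLaplacian G fun v => (deg G v : ℤ) + 1) = fun v => ∑ c, row v c := by
    have hcard : ∀ u v : G.vertexSet,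
        Fintype.card {e : β // G.IsLink e u v} = edgeMult G u v := fun u v =>
      Nat.card_eq_fintype_card.symm.trans (Nat.card_coe_set_eq _)
    funext v
    rw [Fintype.sum_option, Fintype.sum_sigma]
    simp only [row, Option.map_none, Option.map_some, Option.elim, Finset.sum_const,
      Finset.card_univ, hcard]
    ext w
    simp [genLaplacian, deg, Finset.sum_apply, Matrix.diagonal_apply, Pi.single_apply,
      mul_sub, Finset.sum_sub_distrib, eq_comm]
    split_ifs <;> simp [edgeMult_comm G _ v, add_comm, sub_eq_add_neg, add_left_comm]
  rw [hrow, numRootedSpanningForests_eq_ncard]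
  -- Multilinearity in the rows turns the determinant into a sum of determinants of parent matrices
  -- over all choices.
  have := (Matrix.detRowAlternating (n := G.vertexSet) (R := ℤ)).toMultilinearMap.map_sum row
  refine Eq.trans ?_ this.symm
  have hdet : ∀ φ : ∀ v, Option (OutEdge G v), Matrix.det (fun v => row v (φ v)) =
      if IsForestMap (parentOf φ) then 1 else 0 := by
    intro φ
    split_ifs with h
    · exact det_parentMatrix_of_isForestMap h
    · exact det_parentMatrix_of_not_isForestMap h
  refine Eq.trans ?_ (Finset.sum_congr rfl fun φ _ => (hdet φ).symm)
  rw [Finset.sum_boole, Set.ncard_eq_toFinset_card']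
  simp

end ForestTheorem

end CirculantFoliation
namespace CirculantFoliation

/-! ### Fourier diagonalization of block circulant matrices. -/

section BlockCirculant

open ZMod Kronecker

variable {n : ℕ} [NeZero n] {V : Type*} [Fintype V] [DecidableEq V]

/-- The matrix of the discrete Fourier transform on `ZMod n`. -/
noncomputable def fourierMatrix (n : ℕ) [NeZero n] : Matrix (ZMod n) (ZMod n) ℂ :=
  Matrix.of fun j k => stdAddChar (j * k)

lemma det_fourierMatrix_ne_zero : (fourierMatrix n).det ≠ 0 := by
  have h : fourierMatrix n * (Matrix.of fun j k => stdAddChar (-(j * k))) =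
      (n : ℂ) • (1 : Matrix (ZMod n) (ZMod n) ℂ) := by
    ext j k
    have := AddChar.sum_mulShift (j - k) (isPrimitive_stdAddChar n)
    rw [ZMod.card] at this
    simp only [fourierMatrix, Matrix.mul_apply, Matrix.of_apply, ← AddChar.map_add_eq_mul,
      Matrix.smul_apply, Matrix.one_apply, smul_eq_mul, mul_ite, mul_one, mul_zero]
    simp only [sub_eq_zero, Nat.cast_ite, Nat.cast_zero] at this
    rw [← this]
    exact Finset.sum_congr rfl fun x _ => by congr 1; ring
  intro h0
  have hd := congrArg Matrix.det h
  rw [Matrix.det_mul, h0, zero_mul, Matrix.det_smul, Matrix.det_one, mul_one] at hd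
  exact pow_ne_zero _ (Nat.cast_ne_zero.2 (NeZero.ne n)) hd.symm

/-- The determinant of a block circulant matrix. -/
theorem det_blockCirculant (B : ZMod n → Matrix V V ℂ) :
    (Matrix.of fun p q : V × ZMod n => B (p.2 - q.2) p.1 q.1).det =
      ∏ j : ZMod n, (∑ k, stdAddChar (j * k) • B k).det := by
  -- The Fourier matrix on the ℤ/n factor intertwines the block circulant matrix with a block
  -- diagonal one; its nonzero determinant then cancels.
  have h : ((1 : Matrix V V ℂ) ⊗ₖ fourierMatrix n) *
        (Matrix.of fun p q : V × ZMod n => B (p.2 - q.2) p.1 q.1) =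
      Matrix.blockDiagonal (fun j => ∑ k, stdAddChar (j * k) • B k) *
        ((1 : Matrix V V ℂ) ⊗ₖ fourierMatrix n) := by
    ext ⟨u, j⟩ ⟨v, l⟩
    simp only [fourierMatrix, Matrix.mul_apply, Fintype.sum_prod_type, Matrix.kroneckerMap_apply,
      Matrix.of_apply, Matrix.one_apply, ite_mul, one_mul, zero_mul, Matrix.blockDiagonal_apply,
      Matrix.sum_apply, Matrix.smul_apply, smul_eq_mul, mul_ite, mul_zero]
    simp only [Finset.sum_ite_irrel, Finset.sum_const_zero, Finset.sum_ite_eq, Finset.mem_univ,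
      if_true, Finset.sum_ite_eq']
    rw [Finset.sum_mul]
    refine Fintype.sum_equiv (Equiv.subRight l) _ _ fun k => ?_
    rw [Equiv.subRight_apply, mul_right_comm, ← AddChar.map_add_eq_mul]
    congr 2
    ring
  have hd := congrArg Matrix.det h
  rw [Matrix.det_mul, Matrix.det_mul, Matrix.det_blockDiagonal, mul_comm] at hd
  refine mul_right_cancel₀ ?_ hd
  rw [Matrix.det_kronecker, Matrix.det_one, one_pow, one_mul]
  exact pow_ne_zero _ det_fourierMatrix_ne_zero

end BlockCirculant

/-! ### The Laplacian of a circulant foliation and its Fourier factors. -/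

section Foliation

variable {α β : Type*} (H : Graph α β) (n : ℕ)

lemma foliation_edgeSet_finite [NeZero n] [Finite H.vertexSet] (hE : H.edgeSet.Finite)
    (G : H.vertexSet → SimpleGraph (ZMod n)) : (foliation H n G).edgeSet.Finite := by
  refine ((Set.finite_univ (α := ZMod n)).prod hE |>.image Sum.inl).union
    ((Set.finite_univ (α := H.vertexSet × Sym2 (ZMod n))).image Sum.inr) |>.subset ?_
  rintro (⟨k, e⟩ | p) he
  · obtain ⟨x, y, -, -, h⟩ := Graph.exists_isLink_of_mem_edgeSet he
    exact Or.inl ⟨(k, e), ⟨trivial, h.edge_mem⟩, rfl⟩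
  · exact Or.inr ⟨p, trivial, rfl⟩

/-- The vertices of a foliation over `H` with fibres on `ZMod n`. -/
def foliationVertexEquiv (G : H.vertexSet → SimpleGraph (ZMod n)) :
    (foliation H n G).vertexSet ≃ H.vertexSet × ZMod n where
  toFun x := (⟨x.1.2, x.2⟩, x.1.1)
  invFun p := ⟨(p.2, p.1), p.1.2⟩
  left_inv _ := rfl
  right_inv _ := rfl

open Classical in
lemma edgeMult_foliation (hE : H.edgeSet.Finite) (G : H.vertexSet → SimpleGraph (ZMod n))
    (p q : H.vertexSet × ZMod n) :
    edgeMult (foliation H n G) ((foliationVertexEquiv H n G).symm p)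
      ((foliationVertexEquiv H n G).symm q) =
      (if p.2 = q.2 then edgeMult H p.1 q.1 else 0) +
        if p.1 = q.1 ∧ (G p.1).Adj p.2 q.2 then 1 else 0 := by
  obtain ⟨u, k⟩ := p
  obtain ⟨v, l⟩ := q
  have hset : {e | (foliation H n G).IsLink e ((foliationVertexEquiv H n G).symm (u, k))
      ((foliationVertexEquiv H n G).symm (v, l))} =
      Sum.inl '' (Prod.mk k '' {e | k = l ∧ H.IsLink e u v}) ∪
      Sum.inr '' {p | p = (u, s(k, l)) ∧ (u = v ∧ (G u).Adj k l)} := by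
    ext (⟨k', e⟩ | ⟨w, e⟩)
    · change (k = k' ∧ l = k' ∧ H.IsLink e u v) ↔ _
      simp only [Set.mem_union, Set.mem_image, Set.mem_ofPred_eq, Sum.inl.injEq, reduceCtorEq,
        and_false, exists_false, or_false, exists_eq_right, Prod.mk.injEq]
      constructor
      · rintro ⟨rfl, rfl, h⟩
        exact ⟨e, ⟨rfl, h⟩, rfl, rfl⟩
      · rintro ⟨e, ⟨rfl, h⟩, rfl, rfl⟩
        exact ⟨rfl, rfl, h⟩
    · change ((u : α) = w ∧ (v : α) = w ∧ e = s(k, l) ∧ (G w).Adj k l) ↔ _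
      simp only [Set.mem_union, Set.mem_image, Set.mem_ofPred_eq, Sum.inr.injEq, reduceCtorEq,
        and_false, exists_false, false_or, exists_eq_right, Prod.mk.injEq, Subtype.val_inj]
      constructor
      · rintro ⟨rfl, rfl, rfl, h⟩
        exact ⟨⟨rfl, rfl⟩, rfl, h⟩
      · rintro ⟨⟨rfl, rfl⟩, rfl, h⟩
        exact ⟨rfl, rfl, rfl, h⟩
  have hfin₁ : (Sum.inl '' (Prod.mk k '' {e | k = l ∧ H.IsLink e u v}) :
      Set ((ZMod n × β) ⊕ (H.vertexSet × Sym2 (ZMod n)))).Finite :=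
    ((hE.subset fun e he => he.2.edge_mem).image _).image _
  have hfin₂ : (Sum.inr '' {p | p = (u, s(k, l)) ∧ (u = v ∧ (G u).Adj k l)} :
      Set ((ZMod n × β) ⊕ (H.vertexSet × Sym2 (ZMod n)))).Finite :=
    ((Set.finite_singleton _).subset fun p hp => hp.1).image _
  rw [edgeMult, hset, Set.ncard_union_eq ?_ hfin₁ hfin₂, Set.ncard_image_of_injective _ Sum.inl_injective,
    Set.ncard_image_of_injective _ (Prod.mk_right_injective k),
    Set.ncard_image_of_injective _ Sum.inr_injective]
  · congr 1
    · by_cases h : k = l <;> simp [h, edgeMult]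
    · by_cases h : u = v ∧ (G u).Adj k l
      · rw [if_pos h, ← Set.ncard_singleton (u, s(k, l))]
        congr 1
        ext p
        exact and_iff_left h
      · rw [if_neg h, ← Set.ncard_empty (H.vertexSet × Sym2 (ZMod n))]
        congr 1
        ext p
        exact iff_of_false (fun hp => h hp.2) id
  · rw [Set.disjoint_left]
    rintro _ ⟨a, -, rfl⟩ ⟨b, -, h⟩
    exact Sum.inr_ne_inl h

/-- The number of edges joining two vertices of a circulant graph, as a function of their
difference. -/
def circulantWeight (S : Finset ℕ) (x : ZMod n) : ℤ :=
  ∑ s ∈ S, ((if x = (s : ZMod n) then 1 else 0) + if x = -(s : ZMod n) then 1 else 0)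

-- For 1 ≤ s and 2s < n the residues ±s are pairwise distinct over all jumps, so at most one term of
-- the weight is nonzero.
open Classical in
lemma ite_circulant_adj {S : Finset ℕ} (hS : ∀ s ∈ S, 1 ≤ s) (hn : ∀ s ∈ S, 2 * s < n)
    (k l : ZMod n) :
    (if (circulant n S).Adj k l then 1 else 0) = circulantWeight n S (k - l) := by
  have hcast : ∀ s ∈ S, ∀ t ∈ S, (s : ZMod n) = t → s = t := by
    intro s hs t ht h
    rw [ZMod.natCast_eq_natCast_iff] at h
    exact Nat.ModEq.eq_of_lt_of_lt h (by have := hn s hs; omega) (by have := hn t ht; omega)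
  have hneg : ∀ s ∈ S, ∀ t ∈ S, (s : ZMod n) ≠ -t := by
    intro s hs t ht h
    rw [eq_neg_iff_add_eq_zero, ← Nat.cast_add, ZMod.natCast_eq_zero_iff] at h
    have := Nat.le_of_dvd (by have := hS s hs; omega) h
    have := hn s hs
    have := hn t ht
    omega
  have hadj : (circulant n S).Adj k l ↔
      ∃ s ∈ S, k - l = (s : ZMod n) ∨ k - l = -(s : ZMod n) := by
    simp only [circulant, SimpleGraph.circulantGraph_adj, Set.mem_image, Finset.mem_coe]
    constructor
    · rintro ⟨-, ⟨s, hs, h⟩ | ⟨s, hs, h⟩⟩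
      · exact ⟨s, hs, Or.inl h.symm⟩
      · exact ⟨s, hs, Or.inr (by rw [h, neg_sub])⟩
    · rintro ⟨s, hs, h | h⟩
      · refine ⟨fun hkl => ?_, Or.inl ⟨s, hs, h.symm⟩⟩
        have : (s : ZMod n) = -s := by rw [← h, hkl, sub_self, neg_zero]
        exact hneg s hs s hs this
      · refine ⟨fun hkl => ?_, Or.inr ⟨s, hs, by rw [← neg_sub, h, neg_neg]⟩⟩
        have : (s : ZMod n) = -s := by rw [← h, hkl, sub_self]; simpa [hkl] using h.symm
        exact hneg s hs s hs this
  split_ifs with h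
  · obtain ⟨s, hs, hx⟩ := hadj.1 h
    rw [circulantWeight, Finset.sum_eq_single_of_mem s hs]
    · rcases hx with hx | hx
      · rw [hx, if_pos rfl, if_neg (hneg s hs s hs), add_zero]
      · rw [hx, if_pos rfl, if_neg (fun h' => hneg s hs s hs h'.symm), zero_add]
    · intro t ht hts
      rcases hx with hx | hx
      · rw [hx, if_neg fun h' => hts (hcast s hs t ht h').symm, if_neg (hneg s hs t ht), add_zero]
      · rw [hx, if_neg fun h' => hneg t ht s hs h'.symm,
          if_neg fun h' => hts (hcast s hs t ht (neg_injective h')).symm, add_zero]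
  · rw [circulantWeight, Finset.sum_eq_zero]
    intro s hs
    rw [if_neg fun h' => h (hadj.2 ⟨s, hs, Or.inl h'⟩),
      if_neg fun h' => h (hadj.2 ⟨s, hs, Or.inr h'⟩), add_zero]

lemma sum_circulantWeight_mul [NeZero n] {R : Type*} [CommRing R] (S : Finset ℕ) (g : ZMod n → R) :
    ∑ x, (circulantWeight n S x : R) * g x = ∑ s ∈ S, (g s + g (-s)) := by
  simp only [circulantWeight, Int.cast_sum, Int.cast_add, Int.cast_ite, Int.cast_one, Int.cast_zero,
    Finset.sum_mul, add_mul, ite_mul, one_mul, zero_mul]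
  rw [Finset.sum_comm]
  simp [Finset.sum_add_distrib]

variable [DecidableEq α]

lemma genLaplacian_map {A B : Type*} [CommRing A] [CommRing B] (f : A →+* B)
    (x : H.vertexSet → A) : (genLaplacian H x).map f = genLaplacian H fun v => f (x v) := by
  ext u v
  simp [genLaplacian, Matrix.diagonal_apply, apply_ite f]

variable {H} {n} [Fintype H.vertexSet]

-- The entry depends on the ℤ/n coordinates only through their difference, which is the block
-- circulant form.
open Classical in
lemma genLaplacian_foliation [NeZero n] (hE : H.edgeSet.Finite)
    {S : H.vertexSet → Finset ℕ} (hS : ∀ v, ∀ s ∈ S v, 1 ≤ s) (hn : ∀ v, ∀ s ∈ S v, 2 * s < n)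
    [Fintype (foliation H n fun v => circulant n (S v)).vertexSet] (p q : H.vertexSet × ZMod n) :
    genLaplacian (foliation H n fun v => circulant n (S v))
        (fun v => (deg _ v : ℤ) + 1)
        ((foliationVertexEquiv H n _).symm p) ((foliationVertexEquiv H n _).symm q) =
      (if p.2 - q.2 = 0 then
        genLaplacian H (fun v => 2 * ((S v).card : ℤ) + deg H v + 1) p.1 q.1 else 0) -
        if p.1 = q.1 then circulantWeight n (S p.1) (p.2 - q.2) else 0 := by
  have hm : ∀ p q : H.vertexSet × ZMod n, (edgeMult (foliation H n fun v => circulant n (S v))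
      ((foliationVertexEquiv H n _).symm p) ((foliationVertexEquiv H n _).symm q) : ℤ) =
      (if p.2 - q.2 = 0 then (edgeMult H p.1 q.1 : ℤ) else 0) +
        if p.1 = q.1 then circulantWeight n (S p.1) (p.2 - q.2) else 0 := by
    intro p q
    rw [edgeMult_foliation H n hE, ← ite_circulant_adj n (hS _) (hn _)]
    simp only [sub_eq_zero, ite_and]
    push_cast
    rfl
  have hd : (deg (foliation H n fun v => circulant n (S v)) ((foliationVertexEquiv H n _).symm p) : ℤ) =
      2 * ((S p.1).card : ℤ) + deg H p.1 := by
    have h1 : ∑ l, circulantWeight n (S p.1) (l - p.2) = 2 * ((S p.1).card : ℤ) := by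
      have := sum_circulantWeight_mul n (S p.1) (fun _ => (1 : ℤ))
      rw [Fintype.sum_equiv (Equiv.subRight p.2) (fun l => circulantWeight n (S p.1) (l - p.2))
        (fun x => (circulantWeight n (S p.1) x : ℤ) * 1) (fun l => by simp)]
      simp only [Int.cast_id] at this
      rw [this]
      simp [mul_comm]
    simp only [deg]
    rw [← Equiv.sum_comp (foliationVertexEquiv H n _).symm, Nat.cast_sum, Nat.cast_sum]
    simp only [hm]
    rw [Finset.sum_add_distrib, Fintype.sum_prod_type, Fintype.sum_prod_type]
    simp only [sub_eq_zero, Finset.sum_ite_eq', Finset.mem_univ, if_true, Finset.sum_ite_irrel,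
      Finset.sum_const_zero]
    rw [h1, add_comm]
  simp only [genLaplacian]
  rw [Matrix.sub_apply, Matrix.sub_apply, Matrix.diagonal_apply,
    Matrix.diagonal_apply, Matrix.of_apply, Matrix.of_apply, hm, hd]
  obtain ⟨u, k⟩ := p
  obtain ⟨v, l⟩ := q
  simp only [Equiv.apply_eq_iff_eq, Prod.mk.injEq, sub_eq_zero]
  by_cases h₁ : u = v <;> by_cases h₂ : k = l <;> simp [h₁, h₂]
  all_goals ring

open Polynomial in
/-- The polynomial `P` with `polyQ H S = P.comp (2 * X)`. -/
noncomputable def polyP (H : Graph α β) [Fintype H.vertexSet] (S : H.vertexSet → Finset ℕ) : ℤ[X] :=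
  (genLaplacian H fun v => (2 * ((S v).card : ℤ[X]) + (deg H v : ℤ[X]) + 1
    - ∑ s ∈ S v, Chebyshev.C ℤ (s : ℤ))).det

open Polynomial in
lemma polyP_comp (S : H.vertexSet → Finset ℕ) : (polyP H S).comp (2 * X) = polyQ H S := by
  have := RingHom.map_det (Polynomial.compRingHom (2 * X : ℤ[X]))
    (genLaplacian H fun v => (2 * ((S v).card : ℤ[X]) + (deg H v : ℤ[X]) + 1
      - ∑ s ∈ S v, Chebyshev.C ℤ (s : ℤ)))
  rw [RingHom.mapMatrix_apply, genLaplacian_map] at this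
  refine this.trans ?_
  rw [polyQ]
  simp only [map_sub, map_add, map_mul, map_natCast, map_sum, map_one, map_ofNat,
    Polynomial.coe_compRingHom_apply, Chebyshev.C_comp_two_mul_X]

open Polynomial in
lemma aeval_polyP {A : Type*} [CommRing A] (S : H.vertexSet → Finset ℕ) (x : A) :
    aeval x (polyP H S) = (genLaplacian H fun v => (2 * ((S v).card : A) + (deg H v : A) + 1
      - ∑ s ∈ S v, (Chebyshev.C A (s : ℤ)).eval x)).det := by
  have := RingHom.map_det (aeval x : ℤ[X] →ₐ[ℤ] A).toRingHom
    (genLaplacian H fun v => (2 * ((S v).card : ℤ[X]) + (deg H v : ℤ[X]) + 1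
      - ∑ s ∈ S v, Chebyshev.C ℤ (s : ℤ)))
  rw [RingHom.mapMatrix_apply, genLaplacian_map] at this
  refine this.trans ?_
  have h2 : aeval x (2 : ℤ[X]) = 2 := map_ofNat _ 2
  simp [Chebyshev.aeval_C, h2]

open Polynomial in
lemma eval_chebyshevC_add_inv {A : Type*} [CommRing A] {x y : A} (h : x * y = 1) (n : ℕ) :
    (Chebyshev.C A (n : ℤ)).eval (x + y) = x ^ n + y ^ n := by
  rw [← dickson_one_one_eq_chebyshev_C, dickson_one_one_eval_add_inv x y h]

-- The j-th Fourier block is a generalized Laplacian of `H` in which the jump s contributes ζ^(js) +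
-- ζ^(-js) = C_s(ζ^j + ζ^(-j)).
open ZMod in
theorem numRootedSpanningForests_circulantFoliation [NeZero n] (hE : H.edgeSet.Finite)
    {S : H.vertexSet → Finset ℕ} (hS : ∀ v, ∀ s ∈ S v, 1 ≤ s) (hn : ∀ v, ∀ s ∈ S v, 2 * s < n) :
    (numRootedSpanningForests (circulantFoliation H S n) : ℂ) =
      ∏ j : ZMod n, Polynomial.aeval (stdAddChar j + stdAddChar (-j) : ℂ) (polyP H S) := by
  let ε := foliationVertexEquiv H n (fun v => circulant n (S v))
  let _ : Fintype (foliation H n fun v => circulant n (S v)).vertexSet := Fintype.ofEquiv _ ε.symm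
  have hdet := numRootedSpanningForests_eq_det (G := foliation H n fun v => circulant n (S v))
    (foliation_edgeSet_finite H n hE _)
  have hdetC := congrArg (Int.castRingHom ℂ) hdet
  rw [← Matrix.det_submatrix_equiv_self ε.symm, RingHom.map_det] at hdetC
  rw [circulantFoliation]
  refine (Eq.trans (by simp) hdetC).trans ?_
  let B : ZMod n → Matrix H.vertexSet H.vertexSet ℂ := fun x =>
    (if x = 0 then genLaplacian H (fun v => 2 * ((S v).card : ℂ) + deg H v + 1) else 0) -
      Matrix.diagonal fun v => (circulantWeight n (S v) x : ℂ)
  refine Eq.trans (congrArg Matrix.det ?_) ((det_blockCirculant B).trans ?_)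
  · ext p q
    rw [RingHom.mapMatrix_apply, Matrix.map_apply, Matrix.submatrix_apply, Matrix.of_apply]
    refine (congrArg (Int.castRingHom ℂ)
      (genLaplacian_foliation hE hS hn p q)).trans ?_
    simp only [B, Matrix.sub_apply, Matrix.diagonal_apply]
    rw [map_sub]
    congr 1
    · split_ifs
      · rw [← Matrix.map_apply (f := Int.castRingHom ℂ), genLaplacian_map]
        simp
      · simp
    · split_ifs <;> simp
  · refine Finset.prod_congr rfl fun j _ => ?_
    rw [aeval_polyP]
    congr 1
    have hw : stdAddChar j * stdAddChar (-j) = (1 : ℂ) := by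
      rw [← AddChar.map_add_eq_mul, add_neg_cancel, AddChar.map_zero_eq_one]
    have hC : ∀ s : ℕ, (Polynomial.Chebyshev.C ℂ (s : ℤ)).eval (stdAddChar j + stdAddChar (-j)) =
        stdAddChar (j * (s : ZMod n)) + stdAddChar (j * (-(s : ZMod n))) := by
      intro s
      rw [eval_chebyshevC_add_inv hw, ← AddChar.map_nsmul_eq_pow, ← AddChar.map_nsmul_eq_pow,
        nsmul_eq_mul, nsmul_eq_mul]
      congr 2 <;> ring
    simp only [hC]
    simp only [B, smul_sub, Finset.sum_sub_distrib, smul_ite, smul_zero, Finset.sum_ite_eq',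
      Finset.mem_univ, if_true, mul_zero, AddChar.map_zero_eq_one, one_smul]
    ext u v
    have := sum_circulantWeight_mul n (S u) (fun x => (stdAddChar (j * x) : ℂ))
    simp only [← this, genLaplacian, Matrix.sub_apply, Matrix.sum_apply, Matrix.smul_apply,
      Matrix.diagonal_apply, Matrix.of_apply, smul_eq_mul]
    split_ifs with h
    · simp only [mul_comm (stdAddChar _)]
      ring
    · simp

end Foliation

end CirculantFoliation
namespace CirculantFoliation

/-! ### Factoring C_n - 2, and integrality of products over roots. -/

section Chebyshev

open Polynomial ZMod

/-- With x = z + 1/z the left side is (z^m - z^(-m))^2, while S_(m-1) = (z^m - z^(-m))/(z - 1/z) and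
(z - 1/z)^2 = x^2 - 4. -/
lemma chebyshevC_two_mul_sub_two (R : Type*) [CommRing R] (m : ℤ) :
    Chebyshev.C R (2 * m) - 2 = (X - 2) * (X + 2) * Chebyshev.S R (m - 1) ^ 2 := by
  have h1 := Chebyshev.C_mul_C R m m
  have h2 := Chebyshev.C_eq_S_sub_X_mul_S R m
  have h3 := Chebyshev.S_sq_add_S_sq R (m - 1)
  rw [sub_self, Chebyshev.C_zero, ← two_mul] at h1
  rw [sub_add_cancel] at h3
  rw [h2] at h1
  linear_combination -h1 + 4 * h3

/-- The same with half-integer exponents: S_m + S_(m-1) is the quotient of z^(m+1/2) - z^(-m-1/2) by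
z^(1/2) - z^(-1/2), and the squared denominator is x - 2. -/
lemma chebyshevC_two_mul_add_one_sub_two (R : Type*) [CommRing R] (m : ℤ) :
    Chebyshev.C R (2 * m + 1) - 2 =
      (X - 2) * (Chebyshev.S R m + Chebyshev.S R (m - 1)) ^ 2 := by
  have h1 := Chebyshev.C_mul_C R (m + 1) m
  have h2 := Chebyshev.C_eq_S_sub_X_mul_S R m
  have h4 := Chebyshev.C_eq_S_sub_X_mul_S R (m + 1)
  have h3 := Chebyshev.S_sq_add_S_sq R (m - 1)
  have h5 := Chebyshev.S_add_one R m
  rw [show m + 1 + m = 2 * m + 1 by ring, show m + 1 - m = 1 by ring, Chebyshev.C_one] at h1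
  rw [sub_add_cancel] at h3
  rw [add_sub_cancel_right, h5] at h4
  rw [h2, h4] at h1
  linear_combination -h1 + (X + 2) * h3

variable (n : ℕ) [NeZero n]

lemma prod_sub_stdAddChar_mul (x y : ℂ) :
    ∏ j : ZMod n, (x - stdAddChar j * y) = x ^ n - y ^ n := by
  have hn : 0 < n := Nat.pos_of_ne_zero (NeZero.ne n)
  have hζ := Complex.isPrimitiveRoot_exp n (NeZero.ne n)
  rw [hζ.pow_sub_pow_eq_prod_sub_mul x y hn]
  have himg : Finset.univ.image (stdAddChar : ZMod n → ℂ) = nthRootsFinset n (1 : ℂ) := by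
    refine Finset.eq_of_subset_of_card_le ?_ ?_
    · intro z hz
      obtain ⟨j, -, rfl⟩ := Finset.mem_image.1 hz
      rw [mem_nthRootsFinset hn, ← AddChar.map_nsmul_eq_pow, nsmul_eq_mul, CharP.cast_eq_zero,
        zero_mul, AddChar.map_zero_eq_one]
    · rw [Finset.card_image_of_injective _ injective_stdAddChar, hζ.card_nthRootsFinset,
        Finset.card_univ, ZMod.card]
  rw [← himg, Finset.prod_image fun a _ b _ h => injective_stdAddChar h]

/-- At x = z + 1/z each factor splits as (z - ζ^j)(1 - ζ^(-j)/z), and the two products are z^n - 1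
and 1 - z^(-n). -/
lemma prod_X_sub_stdAddChar_add :
    ∏ j : ZMod n, (X - C (stdAddChar j + stdAddChar (-j) : ℂ)) = Chebyshev.C ℂ (n : ℤ) - 2 := by
  refine Polynomial.funext fun x => ?_
  obtain ⟨z, hz0, rfl⟩ : ∃ z : ℂ, z ≠ 0 ∧ z + z⁻¹ = x := by
    obtain ⟨z, hz⟩ := IsAlgClosed.exists_root (X ^ 2 - C x * X + 1 : ℂ[X])
      (by rw [show (X ^ 2 - C x * X + 1 : ℂ[X]) = X ^ 2 - C x * X + C 1 by simp]
          have : (X ^ 2 - C x * X + C 1 : ℂ[X]).degree = 2 := by compute_degree!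
          rw [this]; norm_num)
    have hz' : z ^ 2 - x * z + 1 = 0 := by simpa [IsRoot] using hz
    have hz0 : z ≠ 0 := by
      rintro rfl
      simp at hz'
    refine ⟨z, hz0, ?_⟩
    field_simp
    linear_combination hz'
  rw [eval_prod, eval_sub, eval_chebyshevC_add_inv (mul_inv_cancel₀ hz0)]
  have h1 := prod_sub_stdAddChar_mul n z 1
  have h2 := prod_sub_stdAddChar_mul n 1 z⁻¹
  rw [← Equiv.prod_comp (Equiv.neg (ZMod n))] at h2
  have h3 : ∀ j : ZMod n, (X - C (stdAddChar j + stdAddChar (-j) : ℂ)).eval (z + z⁻¹) =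
      (z - stdAddChar j * 1) * (1 - stdAddChar (Equiv.neg (ZMod n) j) * z⁻¹) := by
    intro j
    have hw : stdAddChar j * stdAddChar (-j) = (1 : ℂ) := by
      rw [← AddChar.map_add_eq_mul, add_neg_cancel, AddChar.map_zero_eq_one]
    rw [Equiv.neg_apply, eval_sub, eval_X, eval_C]
    linear_combination -(z⁻¹) * hw + stdAddChar (-j) * mul_inv_cancel₀ hz0
  rw [Finset.prod_congr rfl fun j _ => h3 j, Finset.prod_mul_distrib, h1, h2]
  have h4 : z ^ n * z⁻¹ ^ n = 1 := by rw [← mul_pow, mul_inv_cancel₀ hz0, one_pow]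
  have h5 : eval (z + z⁻¹) (2 : ℂ[X]) = 2 := eval_ofNat 2 _
  rw [h5]
  linear_combination -h4

/-- The product of the values of an integer polynomial at the roots of another one with leading
coefficient `±1` is an integer. -/
lemma exists_int_eq_prod_roots_aeval (V P : ℤ[X]) (hV : IsUnit V.leadingCoeff) :
    ∃ b : ℤ, ((V.map (Int.castRingHom ℂ)).roots.map fun x => aeval x P).prod = b := by
  have hinj := RingHom.injective_int (Int.castRingHom ℂ)
  -- The resultant is the product sought times a power of the leading coefficient of `V`, here a
  -- sign.
  have h := resultant_eq_prod_eval (V.map (Int.castRingHom ℂ)) (P.map (Int.castRingHom ℂ))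
    P.natDegree natDegree_map_le (IsAlgClosed.splits _)
  rw [resultant_map_map, leadingCoeff_map_of_injective hinj] at h
  have hfun : (fun x : ℂ => aeval x P) = fun x => eval x (P.map (Int.castRingHom ℂ)) := by
    funext x
    rw [eval_map, aeval_def]
    rfl
  rw [hfun]
  rcases Int.isUnit_iff.1 hV with h1 | h1
  · rw [h1] at h
    refine ⟨V.resultant P (V.map (Int.castRingHom ℂ)).natDegree P.natDegree, ?_⟩
    simpa using h.symm
  · rw [h1] at h
    refine ⟨(-1) ^ P.natDegree *
      V.resultant P (V.map (Int.castRingHom ℂ)).natDegree P.natDegree, ?_⟩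
    have h2 : (-1 : ℂ) ^ P.natDegree * (-1) ^ P.natDegree = 1 := by
      rw [← mul_pow]; simp
    push_cast
    rw [show ((resultant V P (V.map (Int.castRingHom ℂ)).natDegree P.natDegree : ℤ) : ℂ) = _ from h]
    simp [← mul_assoc, h2]

/-- The evaluation points are the roots of U V^2, so the roots of `V` are counted twice and their
integer contribution is squared. -/
lemma exists_int_prod_aeval_eq (P U V : ℤ[X])
    (h : Chebyshev.C ℤ (n : ℤ) - 2 = U * V ^ 2) :
    ∃ b : ℤ, ∏ j : ZMod n, aeval (stdAddChar j + stdAddChar (-j) : ℂ) P =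
      ((U.map (Int.castRingHom ℂ)).roots.map fun x => aeval x P).prod * (b : ℂ) ^ 2 := by
  have hinj := RingHom.injective_int (Int.castRingHom ℂ)
  have hC : (Chebyshev.C ℤ (n : ℤ) - 2).map (Int.castRingHom ℂ) =
      ∏ j : ZMod n, (X - C (stdAddChar j + stdAddChar (-j) : ℂ)) := by
    rw [prod_X_sub_stdAddChar_add]
    simp [Chebyshev.map_C]
  have hmonic : (Chebyshev.C ℤ (n : ℤ) - 2).Monic := by
    refine monic_of_injective hinj ?_
    rw [hC]
    exact monic_prod_of_monic _ _ fun j _ => monic_X_sub_C _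
  -- C_n - 2 is monic, so the leading coefficient of `V` divides 1.
  have hunit : IsUnit V.leadingCoeff := by
    have := hmonic.leadingCoeff
    rw [h, leadingCoeff_mul, leadingCoeff_pow] at this
    exact isUnit_of_dvd_one ((dvd_pow_self _ two_ne_zero).trans (Dvd.intro_left _ this))
  obtain ⟨b, hb⟩ := exists_int_eq_prod_roots_aeval V P hunit
  refine ⟨b, ?_⟩
  have hne : (U * V ^ 2).map (Int.castRingHom ℂ) ≠ 0 := by
    rw [← h]
    exact (hmonic.map _).ne_zero
  have hroots := congrArg (fun F : ℂ[X] => (F.roots.map fun x => aeval x P).prod) hC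
  rw [roots_prod _ _ (hC ▸ (hmonic.map _).ne_zero), h] at hroots
  simp only [roots_X_sub_C, Multiset.bind_singleton, Multiset.map_map, Function.comp_def]
    at hroots
  refine hroots.symm.trans ?_
  rw [Polynomial.map_mul, roots_mul (by rwa [← Polynomial.map_mul]), Polynomial.map_pow,
    roots_pow, Multiset.map_add, Multiset.prod_add, Multiset.map_nsmul, Multiset.prod_nsmul, hb]

end Chebyshev

end CirculantFoliation
namespace CirculantFoliation

/-! ### Positive definiteness and square-free parts. -/

section Positivity

variable {α β : Type*} [DecidableEq α] (H : Graph α β) [Fintype H.vertexSet]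

/-- The quadratic form is ∑ c_v x_v^2 + (1/2) ∑ a_uv (x_u - x_v)^2. -/
lemma genLaplacian_deg_add_posDef (c : H.vertexSet → ℝ) (hc : ∀ v, 0 < c v) :
    (genLaplacian H fun v => (deg H v : ℝ) + c v).PosDef := by
  refine Matrix.PosDef.of_dotProduct_mulVec_pos ?_ fun {x} hx => ?_
  · ext u v
    simp [genLaplacian, Matrix.diagonal_apply, edgeMult_comm H v u, eq_comm]
    grind
  · have hsymm : ∑ u, ∑ v, (edgeMult H u v : ℝ) * x v ^ 2 =
        ∑ u, ∑ v, (edgeMult H u v : ℝ) * x u ^ 2 := by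
      rw [Finset.sum_comm]
      exact Finset.sum_congr rfl fun u _ => Finset.sum_congr rfl fun v _ => by
        rw [edgeMult_comm H v u]
    have hsum : star x ⬝ᵥ (genLaplacian H fun v => (deg H v : ℝ) + c v).mulVec x =
        ∑ v, c v * x v ^ 2 + (∑ u, ∑ v, (edgeMult H u v : ℝ) * (x u - x v) ^ 2) / 2 := by
      have hsq : ∑ u, ∑ v, (edgeMult H u v : ℝ) * (x u - x v) ^ 2 =
          2 * ∑ u, ∑ v, (edgeMult H u v : ℝ) * x u ^ 2 -
            2 * ∑ u, ∑ v, (edgeMult H u v : ℝ) * (x u * x v) := by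
        rw [two_mul]
        nth_rewrite 1 [← hsymm]
        simp only [Finset.mul_sum, ← Finset.sum_add_distrib, ← Finset.sum_sub_distrib]
        exact Finset.sum_congr rfl fun u _ => Finset.sum_congr rfl fun v _ => by ring
      have h1 : ∀ u v, x u * ((edgeMult H v u : ℝ) * x u) = edgeMult H u v * x u ^ 2 :=
        fun u v => by rw [edgeMult_comm H v u]; ring
      have h2 : ∀ u v, x u * ((edgeMult H u v : ℝ) * x v) = edgeMult H u v * (x u * x v) :=
        fun u v => by ring
      have h3 : ∀ u, x u * (c u * x u) = c u * x u ^ 2 := fun u => by ring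
      rw [hsq, genLaplacian, Matrix.sub_mulVec, dotProduct_sub]
      simp only [dotProduct, Matrix.mulVec_diagonal]
      simp only [Matrix.mulVec, dotProduct, Matrix.of_apply, star_trivial, Pi.star_apply,
        deg, Nat.cast_sum, Finset.mul_sum, add_mul, mul_add, Finset.sum_mul,
        Finset.sum_add_distrib, h1, h2, h3]
      simp only [← Finset.mul_sum]
      ring
    rw [hsum]
    obtain ⟨v, hv⟩ := Function.ne_iff.1 hx
    refine add_pos_of_pos_of_nonneg ?_ (by positivity)
    refine Finset.sum_pos' (fun u _ => mul_nonneg (hc u).le (sq_nonneg _)) ⟨v, Finset.mem_univ _, ?_⟩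
    exact mul_pos (hc v) (sq_pos_of_ne_zero hv)

lemma det_genLaplacian_deg_add_pos (c : H.vertexSet → ℤ) (hc : ∀ v, 0 < c v) :
    0 < (genLaplacian H fun v => (deg H v : ℤ) + c v).det := by
  have h := (genLaplacian_deg_add_posDef H (fun v => (c v : ℝ))
    fun v => Int.cast_pos.2 (hc v)).det_pos
  have h2 := RingHom.map_det (Int.castRingHom ℝ) (genLaplacian H fun v => (deg H v : ℤ) + c v)
  rw [RingHom.mapMatrix_apply, genLaplacian_map] at h2
  simp only [eq_intCast, Int.cast_add, Int.cast_natCast] at h2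
  rw [← h2] at h
  exact_mod_cast h

lemma exists_isSquarefreePart {N : ℤ} (hN : 0 < N) : ∃ p, IsSquarefreePart p N := by
  obtain ⟨m, rfl⟩ := Int.eq_ofNat_of_zero_le hN.le
  obtain ⟨p, r, -, hr, h, hp⟩ := Nat.sq_mul_squarefree_of_pos (by exact_mod_cast hN : 0 < m)
  exact ⟨p, hp, r, hr, by rw [← h]; push_cast; ring⟩

end Positivity

/-! ### The values at 2 and -2, and the formulas for odd and even n. -/

section Evaluation

open Polynomial

variable {α β : Type*} [DecidableEq α] (H : Graph α β) [Fintype H.vertexSet]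
  (S : H.vertexSet → Finset ℕ)

/-- Every C_s takes the value 2 at 2, so the jumps cancel and the Laplacian of `H` plus the identity
remains. -/
lemma polyP_eval_two (hE : H.edgeSet.Finite) :
    (polyP H S).eval 2 = (numRootedSpanningForests H : ℤ) := by
  rw [numRootedSpanningForests_eq_det hE, ← coe_aeval_eq_eval, aeval_polyP]
  congr 2
  funext v
  simp only [Chebyshev.C_eval_two, Finset.sum_const, nsmul_eq_mul]
  ring

lemma polyP_eval_neg_two : (polyP H S).eval (-2) = (polyQ H S).eval (-1) := by
  rw [← polyP_comp, eval_comp]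
  simp

lemma polyQ_eval_neg_one : (polyQ H S).eval (-1) =
    (genLaplacian H fun v => (deg H v : ℤ) + 4 * (numOddJumps S v : ℤ) + 1).det := by
  rw [← polyP_eval_neg_two, ← coe_aeval_eq_eval, aeval_polyP]
  congr 2
  funext v
  -- C_s(-2) = 2(-1)^s, so each odd jump raises the diagonal entry by 4 and each even jump leaves it
  -- unchanged.
  have h : ∀ s : ℕ, (Chebyshev.C ℤ (s : ℤ)).eval (-2) = 2 - if Odd s then 4 else 0 := by
    intro s
    rw [Chebyshev.C_eval_neg_two]
    split_ifs with hs
    · rw [Int.negOnePow_odd _ (by exact_mod_cast hs)]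
      rfl
    · rw [Int.negOnePow_even _ (by exact_mod_cast Nat.not_odd_iff_even.1 hs)]
      rfl
  simp only [h, Finset.sum_sub_distrib, Finset.sum_const, nsmul_eq_mul, numOddJumps,
    ← Finset.sum_filter]
  ring

variable {H S} {n : ℕ}

lemma exists_forests_eq_of_odd [NeZero n] (hE : H.edgeSet.Finite) (hS : ∀ v, ∀ s ∈ S v, 1 ≤ s)
    (hn : ∀ v, ∀ s ∈ S v, 2 * s < n) (hodd : Odd n) :
    ∃ b : ℤ, (numRootedSpanningForests (circulantFoliation H S n) : ℤ) =
      (numRootedSpanningForests H : ℤ) * b ^ 2 := by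
  obtain ⟨m, rfl⟩ := hodd
  obtain ⟨b, hb⟩ := exists_int_prod_aeval_eq (2 * m + 1) (polyP H S) (X - 2)
    (Chebyshev.S ℤ m + Chebyshev.S ℤ (m - 1))
    (by push_cast; exact chebyshevC_two_mul_add_one_sub_two ℤ m)
  refine ⟨b, Int.cast_injective (α := ℂ) ?_⟩
  have hU : (X - 2 : ℤ[X]).map (Int.castRingHom ℂ) = X - C 2 := by
    simp [map_ofNat C 2]
  rw [← numRootedSpanningForests_circulantFoliation hE hS hn, hU, roots_X_sub_C,
    Multiset.map_singleton, Multiset.prod_singleton] at hb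
  have h2 : aeval (2 : ℂ) (polyP H S) = (((polyP H S).eval 2 : ℤ) : ℂ) := by
    simpa using aeval_algebraMap_apply_eq_algebraMap_eval (A := ℂ) (2 : ℤ) (polyP H S)
  rw [h2, polyP_eval_two H S hE] at hb
  push_cast at hb ⊢
  exact hb

lemma exists_forests_eq_of_even [NeZero n] (hE : H.edgeSet.Finite) (hS : ∀ v, ∀ s ∈ S v, 1 ≤ s)
    (hn : ∀ v, ∀ s ∈ S v, 2 * s < n) (heven : Even n) :
    ∃ b : ℤ, (numRootedSpanningForests (circulantFoliation H S n) : ℤ) =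
      (polyQ H S).eval (-1) * (numRootedSpanningForests H : ℤ) * b ^ 2 := by
  obtain ⟨m, rfl⟩ := even_iff_exists_two_mul.1 heven
  obtain ⟨b, hb⟩ := exists_int_prod_aeval_eq (2 * m) (polyP H S) ((X - 2) * (X + 2))
    (Chebyshev.S ℤ (m - 1)) (by push_cast; exact chebyshevC_two_mul_sub_two ℤ m)
  refine ⟨b, Int.cast_injective (α := ℂ) ?_⟩
  have hU : ((X - 2) * (X + 2) : ℤ[X]).map (Int.castRingHom ℂ) = (X - C 2) * (X - C (-2)) := by
    simp [map_ofNat C 2]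
  rw [← numRootedSpanningForests_circulantFoliation hE hS hn, hU,
    roots_mul (mul_ne_zero (X_sub_C_ne_zero _) (X_sub_C_ne_zero _)), roots_X_sub_C, roots_X_sub_C,
    Multiset.map_add, Multiset.prod_add, Multiset.map_singleton, Multiset.prod_singleton,
    Multiset.map_singleton, Multiset.prod_singleton] at hb
  have h2 : aeval (2 : ℂ) (polyP H S) = (((polyP H S).eval 2 : ℤ) : ℂ) := by
    simpa using aeval_algebraMap_apply_eq_algebraMap_eval (A := ℂ) (2 : ℤ) (polyP H S)
  have h3 : aeval (-2 : ℂ) (polyP H S) = (((polyP H S).eval (-2) : ℤ) : ℂ) := by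
    simpa using aeval_algebraMap_apply_eq_algebraMap_eval (A := ℂ) (-2 : ℤ) (polyP H S)
  rw [h2, h3, polyP_eval_two H S hE, polyP_eval_neg_two] at hb
  push_cast at hb ⊢
  rw [hb]
  ring

end Evaluation

end CirculantFoliation
-- Assembly: extracting the square-free part.
theorem theorem2 {α β : Type*} [DecidableEq α] (H : Graph α β) [H.Loopless]
    [Fintype H.vertexSet] (hE : H.edgeSet.Finite)
    (S : H.vertexSet → Finset ℕ) (hS : ∀ v, ∀ s ∈ S v, 1 ≤ s) :
    (CirculantFoliation.polyQ H S).eval (-1) =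
        (CirculantFoliation.genLaplacian H fun v => (CirculantFoliation.deg H v : ℤ) +
          4 * (CirculantFoliation.numOddJumps S v : ℤ) + 1).det ∧
      ∃ p : ℕ, CirculantFoliation.IsSquarefreePart p ((CirculantFoliation.polyQ H S).eval (-1)) ∧
        ∃ a : ℕ → ℤ, ∀ n : ℕ, 1 ≤ n → (∀ v, ∀ s ∈ S v, 2 * s < n) →
          (Odd n →
            (CirculantFoliation.numRootedSpanningForests
                (CirculantFoliation.circulantFoliation H S n) : ℤ) =
              (CirculantFoliation.numRootedSpanningForests H : ℤ) * a n ^ 2) ∧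
          (Even n →
            (CirculantFoliation.numRootedSpanningForests
                (CirculantFoliation.circulantFoliation H S n) : ℤ) =
              (p : ℤ) * (CirculantFoliation.numRootedSpanningForests H : ℤ) * a n ^ 2) := by
  have hpos : 0 < (CirculantFoliation.polyQ H S).eval (-1) := by
    rw [CirculantFoliation.polyQ_eval_neg_one]
    simp only [add_assoc]
    exact CirculantFoliation.det_genLaplacian_deg_add_pos H _ fun v => by positivity
  obtain ⟨p, hp⟩ := CirculantFoliation.exists_isSquarefreePart hpos
  refine ⟨CirculantFoliation.polyQ_eval_neg_one H S, p, hp, ?_⟩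
  obtain ⟨-, r, -, hr⟩ := hp
  -- No relation between different n is involved, so a(n) may be chosen separately for each n.
  rw [← Classical.skolem (p := fun n (b : ℤ) => 1 ≤ n → (∀ v, ∀ s ∈ S v, 2 * s < n) →
    (Odd n → (CirculantFoliation.numRootedSpanningForests
      (CirculantFoliation.circulantFoliation H S n) : ℤ) =
        (CirculantFoliation.numRootedSpanningForests H : ℤ) * b ^ 2) ∧
    (Even n → (CirculantFoliation.numRootedSpanningForests
      (CirculantFoliation.circulantFoliation H S n) : ℤ) =
        (p : ℤ) * (CirculantFoliation.numRootedSpanningForests H : ℤ) * b ^ 2))]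
  intro n
  by_cases h : 1 ≤ n ∧ ∀ v, ∀ s ∈ S v, 2 * s < n
  · have : NeZero n := ⟨by omega⟩
    rcases Nat.even_or_odd n with he | ho
    · obtain ⟨b, hb⟩ := CirculantFoliation.exists_forests_eq_of_even hE hS h.2 he
      -- The factor r^2 of Q(-1) = p r^2 moves into the square.
      refine ⟨r * b, fun _ _ => ⟨fun ho => absurd he (Nat.not_even_iff_odd.2 ho), fun _ => ?_⟩⟩
      rw [hb, hr]
      ring
    · obtain ⟨b, hb⟩ := CirculantFoliation.exists_forests_eq_of_odd hE hS h.2 ho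
      exact ⟨b, fun _ _ => ⟨fun _ => hb, fun he => absurd he (Nat.not_even_iff_odd.2 ho)⟩⟩
  -- Arbitrary value for inadmissible n.
  · exact ⟨0, fun h1 h2 => absurd ⟨h1, h2⟩ h⟩
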